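/- Cops and Robbers is played on a finite graph or digraph by $m$ cops and one robber: first the cops choose their vertices, then the robber chooses his; afterwards, in each round, every cop moves along an edge (in a digraph, along an arc in its direction) or stays put, and then the robber does likewise. The cops win if after finitely many rounds some cop is on the robber's vertex. The cop number $\mathrm{cop}(\cdot)$ is the least $m$ such that $m$ cops can guarantee to win. A Steiner triple system on a finite set $V$ is a family of $3$-element subsets (triples) of $V$ such that any two distinct points lie in exactly one triple. An oriented Steiner triple graph is a tournament on $V$ obtained from a Steiner triple system on $V$ by orienting each triple $\{a,b,c\}$ as a directed $3$-cycle, in either of the two ways. (1) For every $k\in\mathbb{N}$ there exists an oriented Steiner triple graph $T$ with $\mathrm{cop}(T)\ge k$. (2) The underlying graph of every oriented Steiner triple graph on $n\ge 1$ vertices is the complete graph, which has cop number $1$. (3) For every $k\in\mathbb{N}$ there exists a strongly connected oriented graph $D$ (a digraph without loops and with at most one arc between any two vertices) such that $\mathrm{cop}(D)-\mathrm{cop}(G)>k$, where $G$ is the underlying undirected graph of $D$; moreover $D$ can be chosen with $G$ complete. -/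

import Mathlib

namespace CopsRobbers

/-! ### The game

The game is played on a vertex set `V` along a relation `adj`; for an undirected graph `adj` is
adjacency, for a directed graph `adj u v` says that there is an arc from `u` to `v`. -/

/-- In one turn an agent moves along an edge (or an arc, in its direction) or stays put. -/
def Step {V : Type*} (adj : V → V → Prop) (u v : V) : Prop := u = v ∨ adj u v

/-- The robber's first `t` positions `r 0, …, r (t - 1)`, most recent one first. -/
def history {V : Type*} (r : ℕ → V) : ℕ → List V
  | 0 => []
  | t + 1 => r t :: history r t

/-- A strategy for `k` cops: a function from what the robber has done so far (most recent
position first) to the positions of the cops, `pos []` being the initial placement. After the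
robber has taken up a new position `v`, each cop makes one step. -/
structure CopStrategy {V : Type*} (adj : V → V → Prop) (k : ℕ) where
  pos : List V → Fin k → V
  legal : ∀ (h : List V) (v : V) (i : Fin k), Step adj (pos h i) (pos (v :: h) i)

/-- The strategy wins if, however the robber chooses his first position `r 0` and his later
moves, he is caught after finitely many rounds: either he takes up a position `r t` where a cop
stands, or a cop moves to his position `r t` in the turn that follows. -/
def CopStrategy.Wins {V : Type*} {adj : V → V → Prop} {k : ℕ} (σ : CopStrategy adj k) : Prop :=
  ∀ r : ℕ → V, (∀ t, Step adj (r t) (r (t + 1))) →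
    ∃ (t : ℕ) (i : Fin k), σ.pos (history r t) i = r t ∨ σ.pos (history r (t + 1)) i = r t

/-- `k` cops can guarantee to win. -/
def CopsWin {V : Type*} (adj : V → V → Prop) (k : ℕ) : Prop :=
  ∃ σ : CopStrategy adj k, σ.Wins

/-- On a finite vertex set, one cop per vertex wins, so the set of which the cop number is the
minimum is not empty. -/
theorem copsWin_card {V : Type*} [Finite V] (adj : V → V → Prop) : CopsWin adj (Nat.card V) :=
  ⟨⟨fun _ i => (Finite.equivFin V).symm i, fun _ _ _ => Or.inl rfl⟩,
    fun r _ => ⟨0, Finite.equivFin V (r 0), Or.inl (by simp)⟩⟩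

/-- The fewest number of cops that can guarantee to win (used for finite `V` only). -/
noncomputable def copNumber {V : Type*} (adj : V → V → Prop) : ℕ :=
  sInf {k : ℕ | CopsWin adj k}

/-- The cop number of an undirected graph. -/
noncomputable def graphCop {V : Type*} (G : SimpleGraph V) : ℕ := copNumber G.Adj

/-- The cop number of a directed graph. -/
noncomputable def digraphCop {V : Type*} (D : Digraph V) : ℕ := copNumber D.Adj

/-! ### Oriented graphs and Steiner triple graphs -/

/-- An oriented graph: no loops, and at most one arc between any two vertices. -/
def IsOriented {V : Type*} (D : Digraph V) : Prop :=
  (∀ u, ¬ D.Adj u u) ∧ ∀ u v, D.Adj u v → ¬ D.Adj v u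

/-- The underlying undirected graph. -/
def underlying {V : Type*} (D : Digraph V) : SimpleGraph V := D.toSimpleGraphInclusive

/-- From every vertex there is a directed path to every vertex. -/
def StronglyConnected {V : Type*} (D : Digraph V) : Prop :=
  ∀ u v, Relation.ReflTransGen D.Adj u v

/-- A Steiner triple system on `V`: a family of 3-element subsets such that any two distinct
points lie in exactly one of them. -/
structure SteinerTripleSystem (V : Type*) where
  triples : Set (Finset V)
  card_eq_three : ∀ B ∈ triples, B.card = 3
  unique_triple : ∀ x y : V, x ≠ y → ∃! B : Finset V, B ∈ triples ∧ x ∈ B ∧ y ∈ B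

/-- `D` arises from the Steiner triple system `S` by orienting each triple cyclically: `D` is an
oriented graph in which the arcs inside each triple are those of a directed 3-cycle `a → b → c → a`
on it. (Any two distinct vertices lie in a triple, so there are no other arcs.) -/
def IsCyclicOrientation {V : Type*} (S : SteinerTripleSystem V) (D : Digraph V) : Prop :=
  IsOriented D ∧
    ∀ B ∈ S.triples, ∃ a b c : V, a ≠ b ∧ b ≠ c ∧ c ≠ a ∧ (∀ x, x ∈ B ↔ x = a ∨ x = b ∨ x = c) ∧
      D.Adj a b ∧ D.Adj b c ∧ D.Adj c a

/-- An oriented Steiner triple graph. -/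
def IsSteinerTripleGraph {V : Type*} (D : Digraph V) : Prop :=
  ∃ S : SteinerTripleSystem V, IsCyclicOrientation S D

end CopsRobbers

/-!
If every vertex `v` and every position of `m` cops off `v` admit an out-neighbour `u` of `v` that
dominates all the cops, then `m` cops lose against the robber who always moves to such a `u`:
arcs cannot be traversed backwards, so no cop can step onto `u`.

Every large Steiner triple system has a cyclic orientation of this kind. Fix one cyclic orientation
and reverse each triple independently with probability `1 / 2`. For given `v` and cops, a greedy
choice yields about `n / (6 (m + 1))` candidates `u` such that the triples joining `u` to `v` and to
the cops are distinct, and those of different candidates are disjoint families. Hence the candidates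
succeed independently of each other, each with probability at least `2⁻¹ ^ (m + 1)`, and the
probability that all of them fail is exponentially small in `n`, whereas there are only
`n ^ (m + 1)` positions. Arbitrarily large systems are provided by the lines of affine spaces over
the field with three elements.
-/

namespace CopsRobbers

section Game

variable {V : Type*} {adj : V → V → Prop} {m k : ℕ}

theorem CopsWin.mono [Nonempty V] (hmk : m ≤ k) (h : CopsWin adj m) : CopsWin adj k := by
  obtain ⟨σ, hσ⟩ := h
  obtain ⟨v₀⟩ := ‹Nonempty V›
  refine ⟨⟨fun l i => if hi : (i : ℕ) < m then σ.pos l ⟨i, hi⟩ else v₀, fun l v i => ?_⟩,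
    fun r hr => ?_⟩
  · split_ifs
    · exact σ.legal l v _
    · exact Or.inl rfl
  · obtain ⟨t, i, hcatch⟩ := hσ r hr
    exact ⟨t, i.castLE hmk, by simpa using hcatch⟩

theorem CopsWin.copNumber_le_iff [Nonempty V] (h : CopsWin adj k) :
    copNumber adj ≤ m ↔ CopsWin adj m :=
  ⟨fun hm => (Nat.sInf_mem (s := {k | CopsWin adj k}) ⟨k, h⟩).mono hm,
    fun hm => Nat.sInf_le hm⟩

theorem not_copsWin_zero [Nonempty V] : ¬ CopsWin adj 0 := by
  rintro ⟨σ, hσ⟩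
  obtain ⟨v₀⟩ := ‹Nonempty V›
  obtain ⟨-, i, -⟩ := hσ (fun _ => v₀) fun _ => Or.inl rfl
  exact i.elim0

theorem copsWin_top_one [Nonempty V] : CopsWin (⊤ : SimpleGraph V).Adj 1 := by
  obtain ⟨v₀⟩ := ‹Nonempty V›
  refine ⟨⟨fun l _ => l.headD v₀, fun l v _ => ?_⟩, fun r _ => ⟨0, 0, Or.inr rfl⟩⟩
  simp only [List.headD_cons, Step, SimpleGraph.top_adj]
  exact em _

theorem graphCop_top [Nonempty V] : graphCop (⊤ : SimpleGraph V) = 1 := by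
  refine le_antisymm (copsWin_top_one.copNumber_le_iff.2 copsWin_top_one) ?_
  rw [Nat.one_le_iff_ne_zero, ← Nat.pos_iff_ne_zero, ← not_le]
  exact fun h => not_copsWin_zero (copsWin_top_one.copNumber_le_iff.1 h)

/-- `Safe v c` says that the robber, having just moved to `v` while the cops are at `c`, is not
about to be caught and can keep it that way. -/
theorem not_copsWin_of_safe (Safe : V → (Fin k → V) → Prop)
    (hstart : ∀ c, ∃ v, Safe v c) (hne : ∀ v c, Safe v c → ∀ i, c i ≠ v)
    (hmove : ∀ v c c', Safe v c → (∀ i, Step adj (c i) (c' i)) →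
      (∀ i, c' i ≠ v) ∧ ∃ u, Step adj v u ∧ Safe u c') :
    ¬ CopsWin adj k := by
  rintro ⟨σ, hσ⟩
  have hnext : ∀ p : {p : List V × V // Safe p.2 (σ.pos p.1)},
      ∃ q : {q : List V × V // Safe q.2 (σ.pos q.1)},
        q.1.1 = p.1.2 :: p.1.1 ∧ Step adj p.1.2 q.1.2 := fun ⟨(l, v), hsafe⟩ =>
    let ⟨u, hvu, hu⟩ := (hmove v _ _ hsafe fun i => σ.legal l v i).2
    ⟨⟨(v :: l, u), hu⟩, rfl, hvu⟩
  choose next hnext_history hnext_step using hnext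
  obtain ⟨v₀, hv₀⟩ := hstart (σ.pos [])
  let play (t : ℕ) := next^[t] ⟨([], v₀), hv₀⟩
  let r (t : ℕ) : V := (play t).1.2
  have hplay (t : ℕ) : play (t + 1) = next (play t) := Function.iterate_succ_apply' ..
  have hhistory (t : ℕ) : history r t = (play t).1.1 := by
    induction t with
    | zero => rfl
    | succ t ih => rw [hplay, hnext_history, history, ih]
  obtain ⟨t, i, hcatch⟩ := hσ r fun t => by simpa only [r, hplay] using hnext_step (play t)
  have hsafe : Safe (r t) (σ.pos (history r t)) := by simpa only [hhistory] using (play t).2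
  exact hcatch.elim (hne _ _ hsafe i)
    ((hmove _ _ _ hsafe fun i => σ.legal (history r t) (r t) i).1 i)

/-- A digraph is `m`-evasive if from any vertex free of `m` given cops there is an arc to a vertex
that dominates all the cops. -/
def Evasive (D : Digraph V) (m : ℕ) : Prop :=
  ∀ (v : V) (c : Fin m → V), (∀ i, c i ≠ v) → ∃ u, D.Adj v u ∧ ∀ i, D.Adj u (c i)

variable {D : Digraph V}

theorem Evasive.not_copsWin [Finite V] (h : Evasive D m) (hD : IsOriented D)
    (hm : m < Nat.card V) : ¬ CopsWin D.Adj m := by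
  refine not_copsWin_of_safe (fun v c => ∀ i, D.Adj v (c i)) (fun c => ?_)
    (fun v c hv i hi => hD.1 v (hi ▸ hv i)) (fun v c c' hv hc => ?_)
  · obtain ⟨v₀, hv₀⟩ : ∃ v, ∀ i, c i ≠ v := by
      by_contra! hsurj
      exact hm.not_ge (by simpa using Nat.card_le_card_of_surjective c hsurj)
    obtain ⟨v, -, hv⟩ := h v₀ c hv₀
    exact ⟨v, hv⟩
  · have hfree : ∀ i, c' i ≠ v := by
      rintro i rfl
      rcases hc i with hstay | harc
      · exact hD.1 _ (hstay ▸ hv i)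
      · exact hD.2 _ _ (hv i) harc
    obtain ⟨u, hvu, hu⟩ := h v c' hfree
    exact ⟨hfree, u, Or.inr hvu, hu⟩

theorem Evasive.lt_digraphCop [Finite V] (h : Evasive D m) (hD : IsOriented D)
    (hm : m < Nat.card V) : m < digraphCop D := by
  have : Nonempty V := (Nat.card_pos_iff.1 (Nat.zero_lt_of_lt hm)).1
  rw [digraphCop, ← not_le, (copsWin_card D.Adj).copNumber_le_iff]
  exact h.not_copsWin hD hm

end Game

namespace SteinerTripleSystem

variable {V : Type*} (S : SteinerTripleSystem V) {x y u : V}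

open Classical in
/-- The triple through two distinct points `x` and `y`; by convention `{x}` if `x = y`. -/
noncomputable def triple (x y : V) : Finset V :=
  if h : x = y then {x} else (S.unique_triple x y h).choose

theorem triple_self (x : V) : S.triple x x = {x} := dif_pos rfl

theorem triple_spec (h : x ≠ y) :
    S.triple x y ∈ S.triples ∧ x ∈ S.triple x y ∧ y ∈ S.triple x y := by
  rw [triple, dif_neg h]
  exact (S.unique_triple x y h).choose_spec.1

theorem triple_mem_triples (h : x ≠ y) : S.triple x y ∈ S.triples := (S.triple_spec h).1

theorem left_mem_triple (x y : V) : x ∈ S.triple x y := by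
  rcases eq_or_ne x y with rfl | h
  · simp only [triple_self, Finset.mem_singleton]
  · exact (S.triple_spec h).2.1

theorem right_mem_triple (x y : V) : y ∈ S.triple x y := by
  rcases eq_or_ne x y with rfl | h
  · simp only [triple_self, Finset.mem_singleton]
  · exact (S.triple_spec h).2.2

theorem triple_eq_of_mem {B : Finset V} (h : x ≠ y) (hB : B ∈ S.triples) (hx : x ∈ B)
    (hy : y ∈ B) : S.triple x y = B :=
  (S.unique_triple x y h).unique (S.triple_spec h) ⟨hB, hx, hy⟩

theorem triple_comm (x y : V) : S.triple x y = S.triple y x := by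
  rcases eq_or_ne x y with rfl | h
  · rfl
  · exact S.triple_eq_of_mem h (S.triple_mem_triples h.symm) (S.right_mem_triple y x)
      (S.left_mem_triple y x)

theorem card_triple_le (x y : V) : (S.triple x y).card ≤ 3 := by
  rcases eq_or_ne x y with rfl | h
  · simp only [triple_self, Finset.card_singleton, Nat.one_le_ofNat]
  · exact (S.card_eq_three _ (S.triple_mem_triples h)).le

theorem injOn_triple {P : Finset V} (hu : ∀ a ∈ P, ∀ b ∈ P, u ∉ S.triple a b) :
    Set.InjOn (S.triple u) P := by
  intro a ha b hb hab
  by_contra hne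
  have hua : u ≠ a := by
    rintro rfl
    exact hu u ha u ha (S.left_mem_triple u u)
  have hmem : b ∈ S.triple u a := hab ▸ S.right_mem_triple u b
  refine hu a ha b hb ?_
  rw [S.triple_eq_of_mem hne (S.triple_mem_triples hua) (S.right_mem_triple u a) hmem]
  exact S.left_mem_triple u a

/-- The Steiner triple system of an affine space over `ZMod 3`: three distinct points form a line
exactly if their sum is zero. -/
def affine (M : Type*) [AddCommGroup M] [Module (ZMod 3) M] : SteinerTripleSystem M where
  triples := {B | B.card = 3 ∧ ∑ x ∈ B, x = 0}
  card_eq_three _ hB := hB.1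
  unique_triple x y h := by
    classical
    have hthree (z : M) : 3 • z = 0 := ZModModule.char_nsmul_eq_zero 3 z
    have hx : -(x + y) ≠ x := fun e => h (by linear_combination (norm := module) hthree x + e)
    have hy : -(x + y) ≠ y := fun e => h (by linear_combination (norm := module) -hthree y - e)
    refine ⟨{x, y, -(x + y)}, ⟨⟨?_, ?_⟩, by simp, by simp⟩, ?_⟩
    · exact Finset.card_eq_three.2 ⟨x, y, _, h, hx.symm, hy.symm, rfl⟩
    · have hxnot : x ∉ ({y, -(x + y)} : Finset M) := by
        rw [Finset.mem_insert, Finset.mem_singleton, not_or]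
        exact ⟨h, hx.symm⟩
      rw [Finset.sum_insert hxnot, Finset.sum_pair hy.symm]
      abel
    · rintro B ⟨⟨hcard, hsum⟩, hxB, hyB⟩
      have hyB' : y ∈ B.erase x := Finset.mem_erase.2 ⟨h.symm, hyB⟩
      obtain ⟨z, hz⟩ : ∃ z, (B.erase x).erase y = {z} := by
        rw [← Finset.card_eq_one, Finset.card_erase_of_mem hyB', Finset.card_erase_of_mem hxB,
          hcard]
      rw [← Finset.add_sum_erase B _ hxB, ← Finset.add_sum_erase _ _ hyB', hz,
        Finset.sum_singleton, ← add_assoc] at hsum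
      rw [← Finset.insert_erase hxB, ← Finset.insert_erase hyB', hz,
        eq_neg_of_add_eq_zero_right hsum]

theorem exists_card_ge (N : ℕ) : ∃ n ≥ N, Nonempty (SteinerTripleSystem (Fin n)) := by
  obtain ⟨e⟩ : Nonempty (Fin (3 ^ N) ≃ (Fin N → ZMod 3)) :=
    ⟨(Fintype.equivFinOfCardEq (by simp)).symm⟩
  let _ := e.addCommGroup
  let _ := e.module (ZMod 3)
  exact ⟨3 ^ N, N.lt_pow_self (by norm_num) |>.le, ⟨affine _⟩⟩

end SteinerTripleSystem

section Orientation

variable {V : Type*} {S : SteinerTripleSystem V} {D : Digraph V} {x y : V}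

theorem exists_isCyclicOrientation (S : SteinerTripleSystem V) :
    ∃ D : Digraph V, IsCyclicOrientation S D := by
  classical
  let _ : LinearOrder V := IsWellOrder.linearOrder WellOrderingRel
  let _ : CircularOrder V := LinearOrder.toCircularOrder V
  let D : Digraph V := ⟨fun x y => ∃ z, {x, y, z} ∈ S.triples ∧ sbtw x y z⟩
  refine ⟨D, ⟨fun x ⟨_, _, h⟩ => sbtw_irrefl_left h, ?_⟩, fun B hB => ?_⟩
  · rintro x y ⟨z, hB, hxyz⟩ ⟨w, hB', hyxw⟩
    have hxy : x ≠ y := fun h => sbtw_irrefl_left (h ▸ hxyz)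
    have hBB' : ({x, y, z} : Finset V) = {y, x, w} :=
      (S.unique_triple x y hxy).unique ⟨hB, by simp, by simp⟩ ⟨hB', by simp, by simp⟩
    have hw : w = x ∨ w = y ∨ w = z := by
      have hmem : w ∈ ({x, y, z} : Finset V) := by rw [hBB']; simp
      simpa only [Finset.mem_insert, Finset.mem_singleton] using hmem
    rcases hw with rfl | rfl | rfl
    · exact sbtw_irrefl_right hyxw
    · exact sbtw_irrefl_left_right hyxw
    · exact sbtw_asymm hxyz.cyclic_left hyxw.cyclic_left
  · have hcycle {a b c : V} (hB : {a, b, c} ∈ S.triples) (h : sbtw a b c) :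
        D.Adj a b ∧ D.Adj b c ∧ D.Adj c a := by
      have hbca : ({b, c, a} : Finset V) = {a, b, c} := by grind
      have hcab : ({c, a, b} : Finset V) = {a, b, c} := by grind
      exact ⟨⟨c, hB, h⟩, ⟨a, hbca ▸ hB, h.cyclic_left⟩, ⟨b, hcab ▸ hB, h.cyclic_right⟩⟩
    obtain ⟨a, b, c, hab, hac, hbc, rfl⟩ := Finset.card_eq_three.1 (S.card_eq_three B hB)
    have hsbtw : sbtw a b c ∨ sbtw a c b := by
      by_contra h
      obtain ⟨habc, hacb⟩ := not_or.1 h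
      have := (btw_iff_not_sbtw.2 hacb).cyclic_right.antisymm (btw_iff_not_sbtw.2 habc)
      tauto
    rcases hsbtw with h | h
    · exact ⟨a, b, c, hab, hbc, hac.symm, by simp, hcycle hB h⟩
    · rw [Finset.pair_comm b c] at hB ⊢
      exact ⟨a, c, b, hac, hbc.symm, hab.symm, by simp, hcycle hB h⟩

theorem IsCyclicOrientation.exists_directed_triangle (hD : IsCyclicOrientation S D) (h : x ≠ y) :
    ∃ z, (D.Adj x y ∧ D.Adj y z ∧ D.Adj z x) ∨ (D.Adj y x ∧ D.Adj x z ∧ D.Adj z y) := by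
  obtain ⟨a, b, c, -, -, -, hmem, hab, hbc, hca⟩ := hD.2 _ (S.triple_mem_triples h)
  have hx := (hmem x).1 (S.left_mem_triple x y)
  have hy := (hmem y).1 (S.right_mem_triple x y)
  grind

theorem IsCyclicOrientation.adj_or_adj (hD : IsCyclicOrientation S D) (h : x ≠ y) :
    D.Adj x y ∨ D.Adj y x := by
  obtain ⟨z, hxy | hyx⟩ := hD.exists_directed_triangle h
  · exact Or.inl hxy.1
  · exact Or.inr hyx.1

theorem IsCyclicOrientation.adj_iff_not_adj (hD : IsCyclicOrientation S D) (h : x ≠ y) :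
    D.Adj x y ↔ ¬ D.Adj y x :=
  ⟨hD.1.2 x y, (hD.adj_or_adj h).resolve_right⟩

theorem IsCyclicOrientation.underlying_eq_top (hD : IsCyclicOrientation S D) :
    underlying D = ⊤ := by
  ext x y
  simp only [underlying, Digraph.toSimpleGraphInclusive, SimpleGraph.fromRel_adj,
    SimpleGraph.top_adj, and_iff_left_iff_imp]
  exact hD.adj_or_adj

theorem IsCyclicOrientation.stronglyConnected (hD : IsCyclicOrientation S D) :
    StronglyConnected D := by
  intro x y
  rcases eq_or_ne x y with rfl | hxy
  · exact .refl
  obtain ⟨z, ⟨hxy, -⟩ | ⟨-, hxz, hzy⟩⟩ := hD.exists_directed_triangle hxy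
  · exact .single hxy
  · exact (Relation.ReflTransGen.single hxz).tail hzy

/-- The digraph `D` with the arcs inside each triple `B` of `S` reversed if `f B = false`. -/
def reorientation (S : SteinerTripleSystem V) (D : Digraph V) (f : Finset V → Bool) :
    Digraph V where
  Adj x y := x ≠ y ∧ (f (S.triple x y) = true ↔ D.Adj x y)

theorem IsCyclicOrientation.reorient (hD : IsCyclicOrientation S D) (f : Finset V → Bool) :
    IsCyclicOrientation S (reorientation S D f) := by
  refine ⟨⟨fun x h => h.1 rfl, ?_⟩, fun B hB => ?_⟩
  · rintro x y ⟨hne, hxy⟩ ⟨-, hyx⟩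
    rw [S.triple_comm y x, hxy] at hyx
    have := hD.adj_iff_not_adj hne
    tauto
  · obtain ⟨a, b, c, hab, hbc, hca, hmem, habD, hbcD, hcaD⟩ := hD.2 B hB
    have hadj {x y : V} (hne : x ≠ y) (hx : x ∈ B) (hy : y ∈ B) :
        (reorientation S D f).Adj x y ↔ (f B = true ↔ D.Adj x y) := by
      simp only [reorientation, S.triple_eq_of_mem hne hB hx hy, ne_eq, hne,
        not_false_eq_true, true_and]
    have haB : a ∈ B := (hmem a).2 (by simp)
    have hbB : b ∈ B := (hmem b).2 (by simp)
    have hcB : c ∈ B := (hmem c).2 (by simp)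
    cases hf : f B
    · refine ⟨a, c, b, hca.symm, hbc.symm, hab.symm, fun x => by rw [hmem]; tauto, ?_, ?_, ?_⟩
      · simp [hadj hca.symm haB hcB, hf, hD.1.2 _ _ hcaD]
      · simp [hadj hbc.symm hcB hbB, hf, hD.1.2 _ _ hbcD]
      · simp [hadj hab.symm hbB haB, hf, hD.1.2 _ _ habD]
    · refine ⟨a, b, c, hab, hbc, hca, hmem, ?_, ?_, ?_⟩
      · simp [hadj hab haB hbB, hf, habD]
      · simp [hadj hbc hbB hcB, hf, hbcD]
      · simp [hadj hca hcB haB, hf, hcaD]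

theorem exists_pattern_reorientation (S : SteinerTripleSystem V) (D : Digraph V)
    [DecidableEq V] {u : V} {P : Finset V}
    (hu : u ∉ P) (hinj : Set.InjOn (S.triple u) P) (W : Set V) :
    ∃ τ : Finset V → Bool, ∀ f : Finset V → Bool, (∀ B ∈ P.image (S.triple u), f B = τ B) →
      ∀ c ∈ P, (reorientation S D f).Adj u c ↔ c ∈ W := by
  classical
  refine ⟨fun B => decide (∃ c ∈ P, S.triple u c = B ∧ (D.Adj u c ↔ c ∈ W)),
    fun f hf c hc => ?_⟩
  have hne : u ≠ c := fun h => hu (h ▸ hc)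
  have hunique : (∃ c' ∈ P, S.triple u c' = S.triple u c ∧ (D.Adj u c' ↔ c' ∈ W)) ↔
      (D.Adj u c ↔ c ∈ W) :=
    ⟨fun ⟨c', hc', htriple, h⟩ => hinj hc' hc htriple ▸ h, fun h => ⟨c, hc, rfl, h⟩⟩
  simp only [reorientation, hne, hf _ (Finset.mem_image_of_mem _ hc), hunique, decide_eq_true_eq,
    ne_eq, not_false_eq_true, true_and]
  tauto

end Orientation


section Counting

open Finset

/-- Overwriting `f` on `B` by `τ` forgets at most `card α ^ #B` possibilities for `f` on `B`. -/
theorem card_le_pow_mul_card_filter_eqOn {L α : Type*} [DecidableEq L] [Fintype α]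
    [DecidableEq α] (A : Finset (L → α)) (B : Finset L) (τ : L → α)
    (hA : ∀ f ∈ A, B.piecewise τ f ∈ A) :
    #A ≤ Fintype.card α ^ #B * #{f ∈ A | ∀ l ∈ B, f l = τ l} := by
  let overwrite (f : L → α) : (B → α) × (L → α) := (fun l => f l, B.piecewise τ f)
  have hinj : Function.Injective overwrite := fun f g hfg => funext fun l => by
    by_cases hl : l ∈ B
    · exact congrFun (congrArg Prod.fst hfg) ⟨l, hl⟩
    · simpa [overwrite, hl] using congrFun (congrArg Prod.snd hfg) l
  have hmaps : ∀ f ∈ A, overwrite f ∈ univ ×ˢ {f ∈ A | ∀ l ∈ B, f l = τ l} := fun f hf => by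
    simp +contextual [overwrite, hA f hf]
  simpa [card_product] using card_le_card_of_injOn overwrite hmaps hinj.injOn

theorem card_filter_exists_ne_le {L α : Type*} [DecidableEq L] [Fintype α] [DecidableEq α]
    [Nonempty α] {s : ℕ} (A : Finset (L → α)) {B : Finset L} (hB : #B ≤ s)
    (τ : L → α) (hA : ∀ f ∈ A, B.piecewise τ f ∈ A) :
    (#{f ∈ A | ∃ l ∈ B, f l ≠ τ l} : ℝ) ≤ (1 - (Fintype.card α : ℝ)⁻¹ ^ s) * #A := by
  have hsplit : #{f ∈ A | ∀ l ∈ B, f l = τ l} + #{f ∈ A | ∃ l ∈ B, f l ≠ τ l} = #A := by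
    simpa only [not_forall, exists_prop] using
      card_filter_add_card_filter_not (s := A) (fun f => ∀ l ∈ B, f l = τ l)
  have hagree : #A ≤ Fintype.card α ^ s * #{f ∈ A | ∀ l ∈ B, f l = τ l} :=
    (card_le_pow_mul_card_filter_eqOn A B τ hA).trans (by gcongr; exact Fintype.card_pos)
  have hcard : (0 : ℝ) < Fintype.card α := by exact_mod_cast Fintype.card_pos
  have hfrac : (Fintype.card α : ℝ)⁻¹ ^ s * #A ≤ #{f ∈ A | ∀ l ∈ B, f l = τ l} := by
    rw [inv_pow, inv_mul_le_iff₀ (pow_pos hcard s)]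
    exact_mod_cast hagree
  rify at hsplit
  linarith

theorem card_filter_forall_exists_ne_le {L ι α : Type*} [Fintype L] [DecidableEq L] [Fintype α]
    [DecidableEq α] [Nonempty α] {s : ℕ} (U : Finset ι) {B : ι → Finset L}
    (hB : ∀ j ∈ U, #(B j) ≤ s) (hdisj : (U : Set ι).PairwiseDisjoint B) (τ : ι → L → α) :
    (#{f : L → α | ∀ j ∈ U, ∃ l ∈ B j, f l ≠ τ j l} : ℝ) ≤
      (1 - (Fintype.card α : ℝ)⁻¹ ^ s) ^ #U * Fintype.card (L → α) := by
  classical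
  induction U using Finset.cons_induction with
  | empty => simp
  | cons a U ha ih =>
    rw [coe_cons, Set.pairwiseDisjoint_insert_of_notMem (by simpa using ha)] at hdisj
    specialize ih (fun j hj => hB j (mem_cons_of_mem hj)) hdisj.1
    let A : Finset (L → α) := {f | ∀ j ∈ U, ∃ l ∈ B j, f l ≠ τ j l}
    have hoverwrite : ∀ f ∈ A, (B a).piecewise (τ a) f ∈ A := by
      simp only [A, mem_filter, mem_univ, true_and]
      intro f hf j hj
      obtain ⟨l, hl, hne⟩ := hf j hj
      have hla : l ∉ B a := Finset.disjoint_right.1 (hdisj.2 j hj) hl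
      exact ⟨l, hl, by rwa [piecewise_eq_of_notMem _ _ _ hla]⟩
    have hnonneg : 0 ≤ 1 - (Fintype.card α : ℝ)⁻¹ ^ s :=
      sub_nonneg.2 (pow_le_one₀ (by positivity) (Nat.cast_inv_le_one _))
    calc (#{f : L → α | ∀ j ∈ cons a U ha, ∃ l ∈ B j, f l ≠ τ j l} : ℝ)
        = #{f ∈ A | ∃ l ∈ B a, f l ≠ τ a l} := by
          simp only [A, filter_filter, forall_mem_cons, and_comm]
      _ ≤ (1 - (Fintype.card α : ℝ)⁻¹ ^ s) * #A :=
          card_filter_exists_ne_le A (hB a (mem_cons_self _ _)) (τ a) hoverwrite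
      _ ≤ (1 - (Fintype.card α : ℝ)⁻¹ ^ s) *
          ((1 - (Fintype.card α : ℝ)⁻¹ ^ s) ^ #U * Fintype.card (L → α)) := by gcongr
      _ = (1 - (Fintype.card α : ℝ)⁻¹ ^ s) ^ #(cons a U ha) * Fintype.card (L → α) := by
          rw [card_cons, pow_succ', mul_assoc]

theorem exists_forall_not_of_card_filter_le {ι Ω : Type*} [Fintype ι] [Fintype Ω] [Nonempty Ω]
    (P : ι → Ω → Prop) [∀ i, DecidablePred (P i)] (ε : ℝ)
    (hP : ∀ i, (#{ω | P i ω} : ℝ) ≤ ε * Fintype.card Ω) (hε : Fintype.card ι * ε < 1) :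
    ∃ ω, ∀ i, ¬ P i ω := by
  classical
  by_contra! hcover
  have hle : (Fintype.card Ω : ℝ) ≤ ∑ i, (#{ω | P i ω} : ℝ) := by
    have huniv : (univ : Finset Ω) ⊆ univ.biUnion fun i => {ω | P i ω} := fun ω _ => by
      simpa using hcover ω
    exact_mod_cast (card_le_card huniv).trans card_biUnion_le
  have hpos : (0 : ℝ) < Fintype.card Ω := by exact_mod_cast Fintype.card_pos
  refine lt_irrefl (Fintype.card Ω : ℝ) ?_
  calc (Fintype.card Ω : ℝ) ≤ ∑ i, (#{ω | P i ω} : ℝ) := hle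
    _ ≤ ∑ _i : ι, ε * Fintype.card Ω := sum_le_sum fun i _ => hP i
    _ = Fintype.card ι * ε * Fintype.card Ω := by
      rw [sum_const, card_univ, nsmul_eq_mul, mul_assoc]
    _ < Fintype.card Ω := mul_lt_of_lt_one_left hpos hε

end Counting

open Finset in
theorem SteinerTripleSystem.exists_pairwiseDisjoint_triples {V : Type*} [Fintype V]
    [DecidableEq V] (S : SteinerTripleSystem V) {P : Finset V} (hP : P.Nonempty) (N : ℕ)
    (hN : 3 * ((#P + N) * #P) ≤ Fintype.card V) :
    ∃ U : Finset V, #U = N ∧ (∀ u ∈ U, ∀ a ∈ P, ∀ b ∈ P, u ∉ S.triple a b) ∧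
      (U : Set V).PairwiseDisjoint fun u => P.image (S.triple u) := by
  induction N with
  | zero => exact ⟨∅, by simp⟩
  | succ N ih =>
    obtain ⟨U, rfl, hU, hdisj⟩ := ih (le_trans (by gcongr; omega) hN)
    let covered := ((P ∪ U) ×ˢ P).biUnion fun p => S.triple p.1 p.2
    have hcovered : #covered < Fintype.card V :=
      calc #covered ≤ #((P ∪ U) ×ˢ P) * 3 :=
            card_biUnion_le_card_mul _ _ _ fun p _ => S.card_triple_le p.1 p.2
        _ = #(P ∪ U) * #P * 3 := by rw [card_product]
        _ ≤ (#P + #U) * #P * 3 := by gcongr; exact card_union_le P U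
        _ < Fintype.card V := by have := hP.card_pos; nlinarith
    obtain ⟨u, hu⟩ : ∃ u, u ∉ covered := by
      by_contra! h
      exact hcovered.ne (by rw [eq_univ_of_forall h, card_univ])
    replace hu : ∀ a, (a ∈ P ∨ a ∈ U) → ∀ b ∈ P, u ∉ S.triple a b := by
      simpa [covered] using hu
    have huU : u ∉ U := fun h =>
      let ⟨c, hc⟩ := hP
      hu u (Or.inr h) c hc (S.left_mem_triple u c)
    refine ⟨insert u U, card_insert_of_notMem huU, ?_, ?_⟩
    · rw [forall_mem_insert]
      exact ⟨fun a ha => hu a (Or.inl ha), hU⟩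
    · rw [coe_insert, Set.pairwiseDisjoint_insert_of_notMem (by simpa using huU)]
      refine ⟨hdisj, fun w hw => Finset.disjoint_left.2 fun B hBu hBw => ?_⟩
      obtain ⟨a, -, rfl⟩ := mem_image.1 hBu
      obtain ⟨b, hb, hab⟩ := mem_image.1 hBw
      exact hu w (Or.inr hw) b hb (hab ▸ S.left_mem_triple u a)

section RandomReorientation

open Finset

variable {V : Type*} [Fintype V] {S : SteinerTripleSystem V} {D : Digraph V} {m N : ℕ}

open Classical in
theorem IsCyclicOrientation.card_not_exists_escape_le (hD : IsCyclicOrientation S D)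
    (hN : 3 * ((m + 1 + N) * (m + 1)) ≤ Fintype.card V) {v : V} {c : Fin m → V}
    (hc : ∀ i, c i ≠ v) :
    (#{f : Finset V → Bool | ¬ ∃ u, (reorientation S D f).Adj v u ∧
        ∀ i, (reorientation S D f).Adj u (c i)} : ℝ) ≤
      (1 - 2⁻¹ ^ (m + 1)) ^ N * Fintype.card (Finset V → Bool) := by
  let P : Finset V := insert v (univ.image c)
  have hP : #P ≤ m + 1 :=
    (card_insert_le _ _).trans (by gcongr; exact card_image_le.trans (by simp))
  obtain ⟨U, rfl, hfree, hdisj⟩ :=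
    S.exists_pairwiseDisjoint_triples (insert_nonempty v _ : P.Nonempty) N
      (le_trans (by gcongr) hN)
  have huP : ∀ u ∈ U, u ∉ P := fun u hu huP => hfree u hu u huP u huP (S.left_mem_triple u u)
  have hpattern : ∀ u ∈ U, ∃ τ : Finset V → Bool, ∀ f : Finset V → Bool,
      (∀ B ∈ P.image (S.triple u), f B = τ B) →
        ∀ x ∈ P, (reorientation S D f).Adj u x ↔ x ∈ ({v}ᶜ : Set V) := fun u hu =>
    exists_pattern_reorientation S D (huP u hu) (S.injOn_triple (hfree u hu)) _
  choose! τ hτ using hpattern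
  have havoid := card_filter_forall_exists_ne_le U
    (fun u _ => (card_image_le (s := P) (f := S.triple u)).trans hP) hdisj τ
  rw [Fintype.card_bool, Nat.cast_two] at havoid
  refine le_trans (Nat.cast_le.2 (card_le_card fun f hf => ?_)) havoid
  simp only [mem_filter, mem_univ, true_and] at hf ⊢
  intro u hu
  by_contra! hmatch
  have hadj := hτ u hu f hmatch
  have hvP : v ∈ P := mem_insert_self _ _
  have hvu : v ≠ u := fun h => huP u hu (h ▸ hvP)
  refine hf ⟨u, ((hD.reorient f).adj_iff_not_adj hvu).2 ?_, fun i => ?_⟩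
  · simp [hadj v hvP]
  · have hciP : c i ∈ P := mem_insert_of_mem (mem_image_of_mem _ (mem_univ i))
    exact (hadj _ hciP).2 (hc i)

theorem IsCyclicOrientation.exists_evasive_reorientation (hD : IsCyclicOrientation S D)
    (hN : 3 * ((m + 1 + N) * (m + 1)) ≤ Fintype.card V)
    (hsmall : (Fintype.card V : ℝ) ^ (m + 1) * (1 - 2⁻¹ ^ (m + 1)) ^ N < 1) :
    ∃ f, Evasive (reorientation S D f) m := by
  classical
  let Position := {p : V × (Fin m → V) // ∀ i, p.2 i ≠ p.1}
  have hcard : (Fintype.card Position : ℝ) ≤ (Fintype.card V : ℝ) ^ (m + 1) := by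
    have hprod : Fintype.card (V × (Fin m → V)) = Fintype.card V ^ (m + 1) := by
      rw [Fintype.card_prod, Fintype.card_fun, Fintype.card_fin, pow_succ']
    exact_mod_cast (Fintype.card_subtype_le _).trans_eq hprod
  have hnonneg : (0 : ℝ) ≤ 1 - 2⁻¹ ^ (m + 1) :=
    sub_nonneg.2 (pow_le_one₀ (by norm_num) (by norm_num))
  obtain ⟨f, hf⟩ := exists_forall_not_of_card_filter_le
    (fun (p : Position) f => ¬ ∃ u, (reorientation S D f).Adj p.1.1 u ∧
      ∀ i, (reorientation S D f).Adj u (p.1.2 i)) _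
    (fun p => hD.card_not_exists_escape_le hN p.2)
    ((mul_le_mul_of_nonneg_right hcard (by positivity)).trans_lt hsmall)
  exact ⟨f, fun v c hc => not_not.1 (hf ⟨(v, c), hc⟩)⟩

end RandomReorientation

open Filter Topology in
theorem tendsto_pow_mul_pow_div_atTop {r : ℝ} (hr₀ : 0 ≤ r) (hr₁ : r < 1) (s : ℕ) {a : ℕ}
    (ha : a ≠ 0) : Tendsto (fun n : ℕ => (n : ℝ) ^ s * r ^ (n / a)) atTop (𝓝 0) := by
  have hdiv : Tendsto (fun n : ℕ => (2 * a : ℝ) ^ s * (((n / a : ℕ) : ℝ) ^ s * r ^ (n / a)))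
      atTop (𝓝 0) := by
    simpa using ((tendsto_pow_const_mul_const_pow_of_lt_one s hr₀ hr₁).comp
      (Nat.tendsto_div_const_atTop ha)).const_mul ((2 * a : ℝ) ^ s)
  refine squeeze_zero' (Eventually.of_forall fun n => by positivity) ?_ hdiv
  filter_upwards [eventually_ge_atTop a] with n hn
  have hle : n ≤ 2 * a * (n / a) := by
    have hq : 1 ≤ n / a := (Nat.one_le_div_iff (Nat.pos_of_ne_zero ha)).2 hn
    have := Nat.lt_mul_div_succ n (Nat.pos_of_ne_zero ha)
    nlinarith
  rw [← mul_assoc, ← mul_pow]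
  gcongr
  exact_mod_cast hle

open Filter Topology in
theorem exists_isCyclicOrientation_lt_digraphCop (m : ℕ) :
    ∀ᶠ n in atTop, ∀ S : SteinerTripleSystem (Fin n),
      ∃ D, IsCyclicOrientation S D ∧ m < digraphCop D := by
  have hlt : (1 : ℝ) - 2⁻¹ ^ (m + 1) < 1 := sub_lt_self _ (by positivity)
  have hnonneg : (0 : ℝ) ≤ 1 - 2⁻¹ ^ (m + 1) :=
    sub_nonneg.2 (pow_le_one₀ (by norm_num) (by norm_num))
  have hlim := tendsto_pow_mul_pow_div_atTop hnonneg hlt (m + 1) (a := 6 * (m + 1)) (by simp)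
  filter_upwards [hlim.eventually_lt_const one_pos, eventually_ge_atTop (6 * (m + 1) * (m + 1))]
    with n hsmall hn S
  have hroom : 3 * ((m + 1 + n / (6 * (m + 1))) * (m + 1)) ≤ n := by
    have hdiv := Nat.div_mul_le_self n (6 * (m + 1))
    nlinarith
  obtain ⟨D, hD⟩ := exists_isCyclicOrientation S
  obtain ⟨f, hf⟩ := hD.exists_evasive_reorientation (m := m) (by simpa using hroom)
    (by simpa using hsmall)
  have hm : m < Nat.card (Fin n) := by
    rw [Nat.card_fin]
    nlinarith
  exact ⟨_, hD.reorient f, hf.lt_digraphCop (hD.reorient f).1 hm⟩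

theorem exists_isSteinerTripleGraph_lt_digraphCop (m : ℕ) :
    ∃ n > 0, ∃ T : Digraph (Fin n), IsSteinerTripleGraph T ∧ m < digraphCop T := by
  obtain ⟨N, hN⟩ := Filter.eventually_atTop.1 (exists_isCyclicOrientation_lt_digraphCop m)
  obtain ⟨n, hn, ⟨S⟩⟩ := SteinerTripleSystem.exists_card_ge (max N 1)
  obtain ⟨T, hT, hcop⟩ := hN n ((le_max_left N 1).trans hn) S
  exact ⟨n, (le_max_right N 1).trans hn, T, ⟨S, hT⟩, hcop⟩

end CopsRobbers

theorem mainTheorem11 :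
    (∀ k : ℕ, ∃ (n : ℕ) (T : Digraph (Fin n)),
      CopsRobbers.IsSteinerTripleGraph T ∧ k ≤ CopsRobbers.digraphCop T) ∧
    (∀ (n : ℕ) (T : Digraph (Fin n)), 1 ≤ n → CopsRobbers.IsSteinerTripleGraph T →
      CopsRobbers.underlying T = ⊤ ∧ CopsRobbers.graphCop (CopsRobbers.underlying T) = 1) ∧
    (∀ k : ℕ, ∃ (n : ℕ) (D : Digraph (Fin n)),
      CopsRobbers.IsOriented D ∧ CopsRobbers.StronglyConnected D ∧
      CopsRobbers.underlying D = ⊤ ∧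
      (CopsRobbers.digraphCop D : ℤ) - (CopsRobbers.graphCop (CopsRobbers.underlying D) : ℤ) >
        (k : ℤ)) := by
  have hunderlying : ∀ (n : ℕ) (T : Digraph (Fin n)), 1 ≤ n →
      CopsRobbers.IsSteinerTripleGraph T → CopsRobbers.underlying T = ⊤ ∧
        CopsRobbers.graphCop (CopsRobbers.underlying T) = 1 := fun n T hn ⟨_, hT⟩ => by
    have : Nonempty (Fin n) := ⟨⟨0, hn⟩⟩
    rw [hT.underlying_eq_top]
    exact ⟨rfl, CopsRobbers.graphCop_top⟩
  refine ⟨fun k => ?_, hunderlying, fun k => ?_⟩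
  · obtain ⟨n, -, T, hT, hcop⟩ := CopsRobbers.exists_isSteinerTripleGraph_lt_digraphCop k
    exact ⟨n, T, hT, hcop.le⟩
  · obtain ⟨n, hn, T, hT, hcop⟩ := CopsRobbers.exists_isSteinerTripleGraph_lt_digraphCop (k + 1)
    obtain ⟨htop, hone⟩ := hunderlying n T hn hT
    obtain ⟨S, hS⟩ := hT
    exact ⟨n, T, hS.1, hS.stronglyConnected, htop, by omega⟩
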